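/- Let $n\ge 0$ and let $\Delta_n=\{x\in\mathbb{R}^n : x_i\ge 0 \text{ for all } i,\ \sum_i x_i\le 1\}$ be the $n$-simplex (with barycentric coordinates $x_0=1-\sum_i x_i, x_1,\dots,x_n$), equipped with uniform measure $\mu$, that is, Lebesgue measure on $\Delta_n$ normalized to have total mass $1$. A \emph{$t$-cubature formula} on $\Delta_n$ is a finite set $F$ of points $p\in\mathbb{R}^n$ with real weights $w_p$ such that $\int P\,d\mu=\sum_{p\in F}w_pP(p)$ for every real polynomial $P$ in $n$ variables of total degree at most $t$. It is \emph{positive} if all $w_p>0$ (the points need not lie in $\Delta_n$). A \emph{$t$-design} on $\Delta_n$ is a $t$-cubature formula all of whose weights are equal and all of whose points lie in $\Delta_n$. Then for each $n$ there are constants $C,c>0$, depending only on $n$, such that for every integer $t\ge 1$: (i) every positive $t$-cubature formula on $\Delta_n$ has least weight $\min_{p\in F} w_p\le C\,t^{-2n}$; (ii) every $t$-design on $\Delta_n$ has at least $c\,t^{2n}$ points. -/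

import Mathlib

open MeasureTheory

namespace Cubature

/-- A finite set of points of `ℝⁿ` together with a real weight for each of them (the values of
`weight` away from `points` play no role). -/
structure Formula (n : ℕ) where
  points : Finset (Fin n → ℝ)
  weight : (Fin n → ℝ) → ℝ

namespace Formula

variable {n : ℕ}

/-- The value `P(F) = ∑ₐ wₐ P(pₐ)`. -/
noncomputable def apply (F : Formula n) (P : MvPolynomial (Fin n) ℝ) : ℝ :=
  ∑ p ∈ F.points, F.weight p * MvPolynomial.eval p P

/-- `F` is a cubature formula of degree `t` for the measure `μ`, which is understood to have finite
moments: it integrates every polynomial of degree at most `t` exactly. -/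
def IsCubature (F : Formula n) (t : ℕ) (μ : Measure (Fin n → ℝ)) : Prop :=
  ∀ P : MvPolynomial (Fin n) ℝ, P.totalDegree ≤ t → ∫ x, MvPolynomial.eval x P ∂μ = F.apply P

/-- All weights are positive. The points may lie anywhere in `ℝⁿ`. -/
def IsPositive (F : Formula n) : Prop :=
  ∀ p ∈ F.points, 0 < F.weight p

/-- All weights are equal. -/
def IsEqualWeight (F : Formula n) : Prop :=
  ∀ p ∈ F.points, ∀ q ∈ F.points, F.weight p = F.weight q

/-- Every point is in the interior of the support of `μ`. -/
def IsInterior (F : Formula n) (μ : Measure (Fin n → ℝ)) : Prop :=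
  ∀ p ∈ F.points, p ∈ interior μ.support

/-- Every point is in the support of `μ` and some point is on its boundary. -/
def IsBoundary (F : Formula n) (μ : Measure (Fin n → ℝ)) : Prop :=
  (∀ p ∈ F.points, p ∈ μ.support) ∧ ∃ p ∈ F.points, p ∈ frontier μ.support

/-- A `t`-design: an equal-weight cubature formula of degree `t` that is interior or boundary. -/
def IsDesign (F : Formula n) (t : ℕ) (μ : Measure (Fin n → ℝ)) : Prop :=
  F.IsCubature t μ ∧ F.IsEqualWeight ∧ (F.IsInterior μ ∨ F.IsBoundary μ)

/-- `m` is the least weight of `F`. -/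
def IsLeastWeight (F : Formula n) (m : ℝ) : Prop :=
  IsLeast (F.weight '' (F.points : Set (Fin n → ℝ))) m

end Formula

/-- The `n`-simplex `Δₙ`, embedded in `ℝⁿ` by forgetting the barycentric coordinate
`x₀ = 1 - ∑ᵢ xᵢ`. -/
def simplex (n : ℕ) : Set (Fin n → ℝ) :=
  {x | (∀ i, 0 ≤ x i) ∧ ∑ i, x i ≤ 1}

/-- Uniform measure on `Δₙ`: Lebesgue measure on the simplex, normalized to have total mass 1. -/
noncomputable def uniform (n : ℕ) : Measure (Fin n → ℝ) :=
  ProbabilityTheory.cond volume (simplex n)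

end Cubature

namespace Cubature

open scoped Pointwise

/-! Under the uniform measure, `∑ i, x i` has density proportional to `s ^ (n - 1)` on `[0, 1]` for
`n ≥ 1`, so testing on polynomials in this sum is a one-variable problem at the vertex `0`. An even
power of the Dirichlet kernel in `s = sin² φ` has degree `O(m)`, is nonnegative on all of `ℝ`, is
bounded below for `s ≲ m⁻²`, and has integral of order `m⁻²ⁿ`. Multiplying such a peak by `X - a`,
with `a` a large multiple of `m⁻²`, makes the integral negative, so some point has `∑ i, p i < a`
(`exists_sum_lt`). A coarser peak is bounded below at that point, while its whole integral is
`O(t⁻²ⁿ)`; positivity then bounds the weight (`weight_le`). The weights of a design all equal the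
reciprocal of the number of points, which gives (ii). -/

/-! ### The Dirichlet kernel in the variable `s = sin² φ` -/

open Polynomial in
/-- The Dirichlet kernel `(2m+1)⁻¹ (1 + 2 ∑ⱼ Tⱼ(1 - 2s))`, normalized to be `1` at `s = 0`. -/
noncomputable def dirichletPoly (m : ℕ) : ℝ[X] :=
  C ((2 * (m : ℝ) + 1)⁻¹) *
    (1 + ∑ j ∈ Finset.range m, C 2 * (Chebyshev.T ℝ ((j : ℤ) + 1)).comp (1 - C 2 * X))

open Polynomial in
lemma eval_dirichletPoly (m : ℕ) (s : ℝ) :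
    (dirichletPoly m).eval s = (2 * (m : ℝ) + 1)⁻¹ *
      (1 + ∑ j ∈ Finset.range m, 2 * (Chebyshev.T ℝ ((j : ℤ) + 1)).eval (1 - 2 * s)) := by
  simp [dirichletPoly, eval_finsetSum]

open Polynomial in
lemma natDegree_dirichletPoly_le (m : ℕ) : (dirichletPoly m).natDegree ≤ m := by
  unfold dirichletPoly
  refine (natDegree_C_mul_le _ _).trans ?_
  refine natDegree_add_le_of_degree_le (by simp) ?_
  refine natDegree_sum_le_of_forall_le _ _ fun j hj => ?_
  refine (natDegree_C_mul_le _ _).trans (natDegree_comp_le.trans ?_)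
  have h1 : (1 - C (2 : ℝ) * X).natDegree ≤ 1 := by compute_degree
  have h2 : (Chebyshev.T ℝ ((j : ℤ) + 1)).natDegree = j + 1 := by
    rw [Chebyshev.natDegree_T]; omega
  rw [h2]
  have := Finset.mem_range.1 hj
  nlinarith

lemma abs_sin_nat_mul_le (j : ℕ) (x : ℝ) : |Real.sin (j * x)| ≤ j * |Real.sin x| := by
  induction j with
  | zero => simp
  | succ j ih =>
    have h : Real.sin ((j + 1 : ℕ) * x)
        = Real.sin (j * x) * Real.cos x + Real.cos (j * x) * Real.sin x := by
      rw [← Real.sin_add]; push_cast; ring_nf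
    rw [h]
    refine (abs_add_le _ _).trans ?_
    rw [abs_mul, abs_mul]
    have h1 := mul_le_of_le_one_right (abs_nonneg (Real.sin (j * x))) (Real.abs_cos_le_one x)
    have h2 := mul_le_of_le_one_left (abs_nonneg (Real.sin x)) (Real.abs_cos_le_one (j * x))
    push_cast
    linarith

lemma exists_sin_sq_eq {s : ℝ} (h0 : 0 ≤ s) (h1 : s ≤ 1) :
    ∃ φ : ℝ, Real.sin φ ^ 2 = s ∧ 1 - 2 * s = Real.cos (2 * φ) := by
  have hs : Real.sin (Real.arcsin √s) ^ 2 = s := by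
    rw [Real.sin_arcsin (by linarith [Real.sqrt_nonneg s]) (Real.sqrt_le_one.2 h1),
      Real.sq_sqrt h0]
  refine ⟨Real.arcsin √s, hs, ?_⟩
  rw [Real.cos_two_mul, Real.cos_sq', hs]
  ring

-- With `s = sin² φ` the value is `cos (2jφ) = 1 - 2 sin² (jφ) ≥ 1 - 2j²s`. Negative `s` must be
-- covered because cubature points may lie outside the simplex; there the argument is at least `1`,
-- where `T_j ≥ 1`.
open Polynomial in
lemma half_le_eval_T (j : ℕ) {s : ℝ} (hs : 4 * (j : ℝ) ^ 2 * s ≤ 1) (h1 : s ≤ 1) :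
    1 / 2 ≤ (Chebyshev.T ℝ (j : ℤ)).eval (1 - 2 * s) := by
  rcases le_total s 0 with h | h
  · have := Chebyshev.one_le_eval_T_real j (x := 1 - 2 * s) (by linarith)
    linarith
  · obtain ⟨φ, hφ, he⟩ := exists_sin_sq_eq h h1
    rw [he, Chebyshev.T_real_cos]
    have h2 : Real.cos (((j : ℤ) : ℝ) * (2 * φ)) = 1 - 2 * Real.sin (j * φ) ^ 2 := by
      rw [Int.cast_natCast, mul_left_comm, Real.cos_two_mul, Real.cos_sq']; ring
    rw [h2]
    have h3 := pow_le_pow_left₀ (abs_nonneg _) (abs_sin_nat_mul_le j φ) 2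
    rw [sq_abs, mul_pow, sq_abs, hφ] at h3
    linarith

lemma half_le_eval_dirichletPoly (m : ℕ) {s : ℝ} (hs : (2 * (m : ℝ) + 1) ^ 2 * s ≤ 1) :
    1 / 2 ≤ (dirichletPoly m).eval s := by
  rw [eval_dirichletPoly]
  have hk : (0 : ℝ) < 2 * m + 1 := by positivity
  rw [inv_mul_eq_div, le_div_iff₀ hk]
  have h1 : s ≤ 1 := by nlinarith [Nat.cast_nonneg (α := ℝ) m, sq_nonneg (m : ℝ)]
  have : ∑ j ∈ Finset.range m, (1 : ℝ)
      ≤ ∑ j ∈ Finset.range m,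
        2 * (Polynomial.Chebyshev.T ℝ ((j : ℤ) + 1)).eval (1 - 2 * s) := by
    refine Finset.sum_le_sum fun j hj => ?_
    have hj' : ((j : ℝ) + 1) ≤ m := by exact_mod_cast Finset.mem_range.1 hj
    have := half_le_eval_T (j + 1) (s := s) ?_ h1
    · push_cast at this; linarith
    · rcases le_total s 0 with h | h
      · nlinarith [sq_nonneg (((j + 1 : ℕ) : ℝ))]
      · refine le_trans (mul_le_mul_of_nonneg_right ?_ h) hs
        push_cast
        nlinarith [Nat.cast_nonneg (α := ℝ) j]
  simp only [Finset.sum_const, Finset.card_range, nsmul_eq_mul, mul_one] at this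
  linarith

lemma sin_mul_dirichlet (m : ℕ) (φ : ℝ) :
    Real.sin φ * (1 + ∑ j ∈ Finset.range m, 2 * Real.cos (((j : ℝ) + 1) * (2 * φ)))
      = Real.sin ((2 * m + 1) * φ) := by
  induction m with
  | zero => simp
  | succ m ih =>
    rw [Finset.sum_range_succ, ← add_assoc, mul_add, ih]
    have h1 : (2 * ((m + 1 : ℕ) : ℝ) + 1) * φ = ((m : ℝ) + 1) * (2 * φ) + φ := by push_cast; ring
    have h2 : (2 * (m : ℝ) + 1) * φ = ((m : ℝ) + 1) * (2 * φ) - φ := by ring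
    rw [h1, h2, Real.sin_add, Real.sin_sub]
    ring

/-- Adds two bounds: the kernel is at most `1` in absolute value as an average of cosines, and its
square times `(2m+1)² sin² φ` is `sin² ((2m+1)φ) ≤ 1`. -/
lemma eval_dirichletPoly_sq_le (m : ℕ) {s : ℝ} (h0 : 0 ≤ s) (h1 : s ≤ 1) :
    (dirichletPoly m).eval s ^ 2 * (1 + (2 * (m : ℝ) + 1) ^ 2 * s) ≤ 2 := by
  have hk : (0 : ℝ) < 2 * m + 1 := by positivity
  obtain ⟨φ, hφ, he⟩ := exists_sin_sq_eq h0 h1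
  set S := 1 + ∑ j ∈ Finset.range m, 2 * Real.cos (((j : ℝ) + 1) * (2 * φ)) with hS
  have hD : (2 * (m : ℝ) + 1) * (dirichletPoly m).eval s = S := by
    rw [eval_dirichletPoly, he, mul_inv_cancel_left₀ hk.ne', hS]
    simp [Polynomial.Chebyshev.T_real_cos]
  have hS1 : |S| ≤ 2 * m + 1 := by
    have : |∑ j ∈ Finset.range m, 2 * Real.cos (((j : ℝ) + 1) * (2 * φ))|
        ≤ ∑ j ∈ Finset.range m, (2 : ℝ) := by
      refine (Finset.abs_sum_le_sum_abs _ _).trans (Finset.sum_le_sum fun j _ => ?_)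
      rw [abs_mul, abs_two]
      linarith [Real.abs_cos_le_one (((j : ℝ) + 1) * (2 * φ))]
    simp only [Finset.sum_const, Finset.card_range, nsmul_eq_mul] at this
    refine (abs_add_le _ _).trans ?_
    rw [abs_one]
    linarith
  have h2 : (dirichletPoly m).eval s ^ 2 ≤ 1 := by
    rw [← hD, abs_mul, abs_of_pos hk] at hS1
    have : |(dirichletPoly m).eval s| ≤ 1 := by
      by_contra! h
      nlinarith
    simpa using (sq_le_one_iff_abs_le_one _).2 this
  have h3 : (dirichletPoly m).eval s ^ 2 * ((2 * (m : ℝ) + 1) ^ 2 * s) ≤ 1 := by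
    have h4 : (dirichletPoly m).eval s ^ 2 * ((2 * (m : ℝ) + 1) ^ 2 * s)
        = Real.sin ((2 * m + 1) * φ) ^ 2 := by
      rw [← sin_mul_dirichlet, ← hS, ← hD, ← hφ]; ring
    rw [h4]
    exact Real.sin_sq_le_one _
  linarith

/-! ### The peaking polynomial and its moments -/

/-- The peaking polynomial: an even power of the Dirichlet kernel. -/
noncomputable def peak (E m : ℕ) : Polynomial ℝ := dirichletPoly m ^ (2 * E)

lemma natDegree_peak_le (E m : ℕ) : (peak E m).natDegree ≤ 2 * E * m :=
  Polynomial.natDegree_pow_le.trans (Nat.mul_le_mul_left _ (natDegree_dirichletPoly_le m))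

lemma eval_peak_nonneg (E m : ℕ) (s : ℝ) : 0 ≤ (peak E m).eval s := by
  rw [peak, Polynomial.eval_pow, pow_mul]; positivity

lemma le_eval_peak (E m : ℕ) {s : ℝ} (hs : (2 * (m : ℝ) + 1) ^ 2 * s ≤ 1) :
    (1 / 4) ^ E ≤ (peak E m).eval s := by
  rw [peak, Polynomial.eval_pow, pow_mul]
  refine pow_le_pow_left₀ (by norm_num) ?_ E
  nlinarith [half_le_eval_dirichletPoly m hs]

lemma eval_peak_le (E m : ℕ) {s : ℝ} (h0 : 0 ≤ s) (h1 : s ≤ 1) :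
    (peak E m).eval s * (1 + (2 * (m : ℝ) + 1) ^ 2 * s) ^ E ≤ 2 ^ E := by
  rw [peak, Polynomial.eval_pow, pow_mul, ← mul_pow]
  exact pow_le_pow_left₀ (by positivity) (eval_dirichletPoly_sq_le m h0 h1) E

/-- Moments of the peaking polynomial against powers of `s`. -/
lemma integral_peak_mul_pow_le (E m d : ℕ) (hd : d + 2 ≤ E) :
    ∫ s in (0 : ℝ)..1, (peak E m).eval s * s ^ d
      ≤ 2 ^ E * ((2 * (m : ℝ) + 1) ^ (2 * (d + 1)))⁻¹ := by
  set K : ℝ := (2 * (m : ℝ) + 1) ^ 2 with hK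
  have hKp : 0 < K := by positivity
  have hderiv : ∀ s ∈ Set.uIcc (0 : ℝ) 1,
      HasDerivAt (fun s => s / (1 + K * s)) (((1 + K * s) ^ 2)⁻¹) s := by
    intro s hs
    rw [Set.uIcc_of_le zero_le_one] at hs
    have hne : 1 + K * s ≠ 0 := by have := mul_nonneg hKp.le hs.1; positivity
    have h := (hasDerivAt_id s).div (((hasDerivAt_id s).const_mul K).const_add 1) hne
    refine h.congr_deriv ?_
    simp only [id]
    rw [inv_eq_one_div]
    congr 1
    ring
  have hcont : ContinuousOn (fun s : ℝ => ((1 + K * s) ^ 2)⁻¹) (Set.uIcc 0 1) := by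
    refine ContinuousOn.inv₀ (by fun_prop) fun s hs => ?_
    rw [Set.uIcc_of_le zero_le_one] at hs
    have := mul_nonneg hKp.le hs.1
    positivity
  have hint := intervalIntegral.integral_eq_sub_of_hasDerivAt hderiv hcont.intervalIntegrable
  -- Of the `E` decay factors `1 + K * s`, `d` absorb `(K * s) ^ d` and two make the integral
  -- `O(1/K)`.
  calc ∫ s in (0 : ℝ)..1, (peak E m).eval s * s ^ d
      ≤ ∫ s in (0 : ℝ)..1, 2 ^ E * (K ^ d)⁻¹ * ((1 + K * s) ^ 2)⁻¹ := by
        refine intervalIntegral.integral_mono_on zero_le_one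
          (Continuous.intervalIntegrable (by fun_prop) _ _)
          (hcont.intervalIntegrable.const_mul _) fun s hs => ?_
        have hKs := mul_nonneg hKp.le hs.1
        have h1 : (1 + K * s) ^ (d + 2) ≤ (1 + K * s) ^ E :=
          pow_le_pow_right₀ (by linarith) hd
        have h2 : (K * s) ^ d ≤ (1 + K * s) ^ d := pow_le_pow_left₀ hKs (by linarith) d
        have h3 := eval_peak_le E m hs.1 hs.2
        have h4 := eval_peak_nonneg E m s
        rw [← hK] at h3
        rw [mul_assoc, ← mul_inv, ← div_eq_mul_inv, le_div_iff₀ (by positivity)]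
        calc (peak E m).eval s * s ^ d * (K ^ d * (1 + K * s) ^ 2)
            = (peak E m).eval s * ((K * s) ^ d * (1 + K * s) ^ 2) := by
              rw [mul_pow K s d, mul_comm (K ^ d) (s ^ d), mul_assoc, mul_assoc]
          _ ≤ (peak E m).eval s * ((1 + K * s) ^ d * (1 + K * s) ^ 2) := by gcongr
          _ = (peak E m).eval s * (1 + K * s) ^ (d + 2) := by ring
          _ ≤ _ := (mul_le_mul_of_nonneg_left h1 h4).trans h3
    _ = 2 ^ E * (K ^ d)⁻¹ * (1 / (1 + K)) := by
        rw [intervalIntegral.integral_const_mul, hint]; simp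
    _ ≤ 2 ^ E * (K ^ d)⁻¹ * (1 / K) := by gcongr; linarith
    _ = _ := by rw [hK, one_div, mul_assoc, ← mul_inv, ← pow_succ, ← pow_mul]

/-- It suffices to integrate over `[0, K⁻¹]`, where the peak is at least `(1 / 4) ^ E`. -/
lemma le_integral_peak_mul_pow (E m d : ℕ) :
    (1 / 4) ^ E * ((d : ℝ) + 1)⁻¹ * ((2 * (m : ℝ) + 1) ^ (2 * (d + 1)))⁻¹
      ≤ ∫ s in (0 : ℝ)..1, (peak E m).eval s * s ^ d := by
  set K : ℝ := (2 * (m : ℝ) + 1) ^ 2 with hK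
  have hK1 : 1 ≤ K := by rw [hK]; exact one_le_pow₀ (by linarith [Nat.cast_nonneg (α := ℝ) m])
  have hKi : 0 ≤ K⁻¹ := by positivity
  calc (1 / 4 : ℝ) ^ E * ((d : ℝ) + 1)⁻¹ * ((2 * (m : ℝ) + 1) ^ (2 * (d + 1)))⁻¹
      = ∫ s in (0 : ℝ)..K⁻¹, (1 / 4) ^ E * s ^ d := by
        rw [intervalIntegral.integral_const_mul, integral_pow, pow_mul, ← hK,
          zero_pow d.succ_ne_zero, sub_zero, inv_pow, div_eq_mul_inv _ ((d : ℝ) + 1), mul_assoc,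
          mul_comm (((d : ℝ) + 1)⁻¹)]
    _ ≤ ∫ s in (0 : ℝ)..K⁻¹, (peak E m).eval s * s ^ d := by
        refine intervalIntegral.integral_mono_on hKi
          (Continuous.intervalIntegrable (by fun_prop) _ _)
          (Continuous.intervalIntegrable (by fun_prop) _ _) fun s hs => ?_
        refine mul_le_mul_of_nonneg_right (le_eval_peak E m ?_) (pow_nonneg hs.1 d)
        rw [← hK]
        have := mul_le_mul_of_nonneg_left hs.2 (by positivity : 0 ≤ K)
        rwa [mul_inv_cancel₀ (by positivity)] at this
    _ ≤ _ := by
        refine intervalIntegral.integral_mono_interval le_rfl hKi (inv_le_one_of_one_le₀ hK1) ?_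
          (Continuous.intervalIntegrable (by fun_prop) _ _)
        refine (ae_restrict_iff' measurableSet_Ioc).2 (.of_forall fun s hs => ?_)
        exact mul_nonneg (eval_peak_nonneg E m s) (pow_nonneg hs.1.le d)

/-! ### Uniform measure on the simplex and the law of the coordinate sum -/

lemma isClosed_simplex (n : ℕ) : IsClosed (simplex n) := by
  unfold simplex
  simp only [Set.ofPred_and, Set.ofPred_forall]
  exact (isClosed_iInter fun i => isClosed_le (by fun_prop) (by fun_prop)).inter
    (isClosed_le (by fun_prop) (by fun_prop))

lemma simplex_subset_Icc (n : ℕ) : simplex n ⊆ Set.Icc 0 1 := fun _ hx =>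
  ⟨fun i => hx.1 i, fun i =>
    (Finset.single_le_sum (fun j _ => hx.1 j) (Finset.mem_univ i)).trans hx.2⟩

lemma volume_simplex_ne_top (n : ℕ) : volume (simplex n) ≠ ⊤ :=
  ((measure_mono (simplex_subset_Icc n)).trans_lt
    (isCompact_Icc.measure_lt_top)).ne

lemma volume_simplex_ne_zero (n : ℕ) : volume (simplex n) ≠ 0 := by
  have hsub : (Set.univ.pi fun _ : Fin n => Set.Ioo (0 : ℝ) (((n : ℝ) + 1)⁻¹)) ⊆ simplex n := by
    intro x hx
    have hx' : ∀ i, 0 < x i ∧ x i < ((n : ℝ) + 1)⁻¹ := fun i => hx i trivial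
    refine ⟨fun i => (hx' i).1.le, ?_⟩
    calc ∑ i, x i ≤ ∑ _i : Fin n, ((n : ℝ) + 1)⁻¹ := Finset.sum_le_sum fun i _ => (hx' i).2.le
      _ = n * ((n : ℝ) + 1)⁻¹ := by simp
      _ ≤ 1 := by rw [← div_eq_mul_inv, div_le_one (by positivity)]; linarith
  refine ne_of_gt (lt_of_lt_of_le ?_ (measure_mono hsub))
  refine (isOpen_set_pi Set.finite_univ fun _ _ => isOpen_Ioo).measure_pos _ ?_
  refine Set.univ_pi_nonempty_iff.2 fun _ => Set.nonempty_Ioo.2 (by positivity)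

instance isProbabilityMeasure_uniform (n : ℕ) : IsProbabilityMeasure (uniform n) :=
  ProbabilityTheory.cond_isProbabilityMeasure_of_finite (volume_simplex_ne_zero n)
    (volume_simplex_ne_top n)

lemma uniform_sum_le_of_neg {n : ℕ} {r : ℝ} (hr : r < 0) :
    uniform n {x | ∑ i, x i ≤ r} = 0 := by
  rw [uniform, ProbabilityTheory.cond_apply (isClosed_simplex n).measurableSet]
  have : simplex n ∩ {x | ∑ i, x i ≤ r} = ∅ := by
    ext x
    simp only [Set.mem_inter_iff, Set.mem_ofPred_eq, Set.mem_empty_iff_false, iff_false, not_and,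
      not_le]
    exact fun hx => hr.trans_le (Finset.sum_nonneg fun i _ => hx.1 i)
  simp [this]

lemma uniform_sum_le_of_one_le {n : ℕ} {r : ℝ} (hr : 1 ≤ r) :
    uniform n {x | ∑ i, x i ≤ r} = 1 := by
  rw [uniform, ProbabilityTheory.cond_apply (isClosed_simplex n).measurableSet]
  have : simplex n ∩ {x | ∑ i, x i ≤ r} = simplex n :=
    Set.inter_eq_left.2 fun x hx => hx.2.trans hr
  rw [this]
  exact ENNReal.inv_mul_cancel (volume_simplex_ne_zero n) (volume_simplex_ne_top n)

/-- The sublevel set within the simplex is its homothetic copy of ratio `r`. -/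
lemma uniform_sum_le {n : ℕ} {r : ℝ} (hr : 0 < r) (hr1 : r ≤ 1) :
    uniform n {x | ∑ i, x i ≤ r} = ENNReal.ofReal (r ^ n) := by
  rw [uniform, ProbabilityTheory.cond_apply (isClosed_simplex n).measurableSet]
  have : simplex n ∩ {x | ∑ i, x i ≤ r} = r • simplex n := by
    ext x
    rw [Set.mem_smul_set_iff_inv_smul_mem₀ hr.ne']
    simp only [simplex, Set.mem_inter_iff, Set.mem_ofPred_eq, Pi.smul_apply, smul_eq_mul,
      ← Finset.mul_sum]
    have h1 : ∀ i, 0 ≤ r⁻¹ * x i ↔ 0 ≤ x i := fun i => mul_nonneg_iff_of_pos_left (by positivity)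
    have h2 : r⁻¹ * ∑ i, x i ≤ 1 ↔ ∑ i, x i ≤ r := by rw [inv_mul_le_iff₀ hr, mul_one]
    simp only [h1, h2]
    exact ⟨fun h => ⟨h.1.1, h.2⟩, fun h => ⟨⟨h.1, h.2.trans hr1⟩, h.2⟩⟩
  rw [this, Measure.addHaar_smul, Module.finrank_fin_fun, abs_of_pos (by positivity), mul_comm,
    mul_assoc, ENNReal.mul_inv_cancel (volume_simplex_ne_zero n) (volume_simplex_ne_top n), mul_one]

lemma lintegral_pow_density (d : ℕ) {r : ℝ} (hr : 0 ≤ r) :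
    ∫⁻ s in Set.Ioc 0 r, ENNReal.ofReal (((d : ℝ) + 1) * s ^ d) = ENNReal.ofReal (r ^ (d + 1)) := by
  rw [← ofReal_integral_eq_lintegral_ofReal, ← intervalIntegral.integral_of_le hr,
    intervalIntegral.integral_const_mul, integral_pow]
  · congr 1
    simp
    field_simp
  · exact (Continuous.integrableOn_Icc (by fun_prop)).mono_set Set.Ioc_subset_Icc_self
  · refine (ae_restrict_iff' measurableSet_Ioc).2 (.of_forall fun s hs => ?_)
    have := hs.1.le
    positivity

/-- The law of `∑ᵢ xᵢ` under the uniform measure on the simplex. -/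
lemma map_sum_uniform (d : ℕ) :
    (uniform (d + 1)).map (fun x => ∑ i, x i) =
      (volume.restrict (Set.Ioc 0 1)).withDensity
        fun s => ENNReal.ofReal (((d : ℝ) + 1) * s ^ d) := by
  have hm : Measurable fun x : Fin (d + 1) → ℝ => ∑ i, x i := by fun_prop
  have := Measure.isProbabilityMeasure_map (μ := uniform (d + 1)) hm.aemeasurable
  refine Measure.ext_of_Iic _ _ fun r => ?_
  rw [Measure.map_apply hm measurableSet_Iic, withDensity_apply _ measurableSet_Iic,
    Measure.restrict_restrict measurableSet_Iic]
  change uniform (d + 1) {x | ∑ i, x i ≤ r} = _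
  have hset : Set.Iic r ∩ Set.Ioc (0 : ℝ) 1 = Set.Ioc 0 (min 1 r) := by
    ext s; simp; tauto
  rw [hset]
  rcases lt_or_ge r 0 with h | h
  · rw [uniform_sum_le_of_neg h, min_eq_right (by linarith), Set.Ioc_eq_empty (by linarith)]
    simp
  rw [lintegral_pow_density d (le_min zero_le_one h)]
  rcases le_total 1 r with h1 | h1
  · rw [uniform_sum_le_of_one_le h1, min_eq_left h1]; simp
  rw [min_eq_right h1]
  rcases h.eq_or_lt with rfl | h0
  · rw [zero_pow d.succ_ne_zero, ENNReal.ofReal_zero, uniform,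
      ProbabilityTheory.cond_apply (isClosed_simplex _).measurableSet]
    have hsub : simplex (d + 1) ∩ {x | ∑ i, x i ≤ 0} ⊆ {0} := fun x hx => funext fun i =>
      (Finset.sum_eq_zero_iff_of_nonneg fun j _ => hx.1.1 j).1
        (le_antisymm hx.2 (Finset.sum_nonneg fun j _ => hx.1.1 j)) i (Finset.mem_univ i)
    rw [measure_mono_null hsub (measure_singleton _), mul_zero]
  · exact uniform_sum_le h0 h1

lemma integral_uniform_sum (d : ℕ) {f : ℝ → ℝ} (hf : Continuous f) :
    ∫ x, f (∑ i, x i) ∂uniform (d + 1) = (d + 1) * ∫ s in (0 : ℝ)..1, f s * s ^ d := by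
  have hm : Measurable fun x : Fin (d + 1) → ℝ => ∑ i, x i := by fun_prop
  rw [← integral_map (f := f) hm.aemeasurable hf.aestronglyMeasurable, map_sum_uniform,
    integral_withDensity_eq_integral_toReal_smul (by fun_prop) (by simp),
    intervalIntegral.integral_of_le zero_le_one, ← integral_const_mul]
  refine setIntegral_congr_fun measurableSet_Ioc fun s hs => ?_
  have := hs.1.le
  simp only [smul_eq_mul]
  rw [ENNReal.toReal_ofReal (by positivity)]
  ring

/-! ### Cubature tested on polynomials in the coordinate sum -/

open MvPolynomial in
lemma totalDegree_aeval_sum_X_le {n : ℕ} (q : Polynomial ℝ) :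
    (Polynomial.aeval (∑ i, X i : MvPolynomial (Fin n) ℝ) q).totalDegree ≤ q.natDegree := by
  rw [Polynomial.aeval_eq_sum_range]
  refine totalDegree_finsetSum_le fun k hk => (totalDegree_smul_le _ _).trans ?_
  have h1 : (∑ i, X i : MvPolynomial (Fin n) ℝ).totalDegree ≤ 1 :=
    totalDegree_finsetSum_le fun i _ => by simp
  exact (totalDegree_pow _ _).trans ((Nat.mul_le_mul_left k h1).trans
    (by simpa using Nat.lt_succ_iff.1 (Finset.mem_range.1 hk)))

lemma eval_aeval_sum_X {n : ℕ} (q : Polynomial ℝ) (x : Fin n → ℝ) :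
    MvPolynomial.eval x (Polynomial.aeval (∑ i, MvPolynomial.X i : MvPolynomial (Fin n) ℝ) q)
      = q.eval (∑ i, x i) := by
  rw [← MvPolynomial.coe_aeval_eq_eval, RingHom.coe_coe, ← Polynomial.aeval_algHom_apply]
  simp [Polynomial.aeval_def]

namespace Formula

/-- Cubature applied to polynomials in `∑ᵢ xᵢ`. -/
lemma IsCubature.sum_weight_mul_eval {d t : ℕ} {F : Formula (d + 1)}
    (hF : F.IsCubature t (uniform (d + 1))) {q : Polynomial ℝ} (hq : q.natDegree ≤ t) :
    ∑ p ∈ F.points, F.weight p * q.eval (∑ i, p i)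
      = (d + 1) * ∫ s in (0 : ℝ)..1, q.eval s * s ^ d := by
  have h := hF _ ((totalDegree_aeval_sum_X_le (n := d + 1) q).trans hq)
  simp only [eval_aeval_sum_X, Formula.apply] at h
  rw [← h]
  exact integral_uniform_sum d q.continuous

lemma IsCubature.sum_weight {n t : ℕ} {F : Formula n} (hF : F.IsCubature t (uniform n)) :
    ∑ p ∈ F.points, F.weight p = 1 := by
  simpa [Formula.apply] using (hF 1 (by simp)).symm

/-- A positive formula has a point near the vertex `0` of the simplex. -/
lemma IsCubature.exists_sum_lt {d t E m : ℕ} {F : Formula (d + 1)}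
    (hF : F.IsCubature t (uniform (d + 1))) (hpos : F.IsPositive) (hE : d + 3 ≤ E)
    (ht : 2 * E * m + 1 ≤ t) {a : ℝ} (ha : 8 ^ E * ((d : ℝ) + 1) < a * (2 * (m : ℝ) + 1) ^ 2) :
    ∃ p ∈ F.points, ∑ i, p i < a := by
  by_contra! hcon
  have hk : (0 : ℝ) < 2 * (m : ℝ) + 1 := by positivity
  -- If every point had `∑ i, p i ≥ a`, this test polynomial would have a nonnegative cubature sum,
  -- against the moment bounds of orders `d + 1` and `d`.
  have hdeg : (peak E m * (Polynomial.X - Polynomial.C a)).natDegree ≤ t := by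
    refine Polynomial.natDegree_mul_le.trans ((Nat.add_le_add (natDegree_peak_le E m) ?_).trans ht)
    exact (Polynomial.natDegree_X_sub_C a).le
  have h := hF.sum_weight_mul_eval hdeg
  have h0 : 0 ≤ ∑ p ∈ F.points,
      F.weight p * (peak E m * (Polynomial.X - Polynomial.C a)).eval (∑ i, p i) := by
    refine Finset.sum_nonneg fun p hp => mul_nonneg (hpos p hp).le ?_
    rw [Polynomial.eval_mul]
    refine mul_nonneg (eval_peak_nonneg _ _ _) ?_
    simpa using hcon p hp
  rw [h] at h0
  have hsplit : ∫ s in (0 : ℝ)..1, (peak E m * (Polynomial.X - Polynomial.C a)).eval s * s ^ d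
      = (∫ s in (0 : ℝ)..1, (peak E m).eval s * s ^ (d + 1))
        - a * ∫ s in (0 : ℝ)..1, (peak E m).eval s * s ^ d := by
    rw [← intervalIntegral.integral_const_mul, ← intervalIntegral.integral_sub
      (Continuous.intervalIntegrable (by fun_prop) _ _)
      (Continuous.intervalIntegrable (by fun_prop) _ _)]
    refine intervalIntegral.integral_congr fun s _ => ?_
    simp only [Polynomial.eval_mul, Polynomial.eval_sub, Polynomial.eval_X, Polynomial.eval_C]
    ring
  have hup := integral_peak_mul_pow_le E m (d + 1) (by omega)
  have hlow := le_integral_peak_mul_pow E m d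
  have hapos : 0 < a := by
    by_contra! h'
    have : 0 < (8 : ℝ) ^ E * ((d : ℝ) + 1) := by positivity
    nlinarith [mul_nonpos_of_nonpos_of_nonneg h' (sq_nonneg (2 * (m : ℝ) + 1))]
  have h1 := nonneg_of_mul_nonneg_right h0 (by positivity : (0 : ℝ) < (d : ℝ) + 1)
  rw [hsplit] at h1
  have h2 := mul_le_mul_of_nonneg_left hlow hapos.le
  have h3 : a * ((1 / 4) ^ E * ((d : ℝ) + 1)⁻¹ * ((2 * (m : ℝ) + 1) ^ (2 * (d + 1)))⁻¹)
      ≤ 2 ^ E * ((2 * (m : ℝ) + 1) ^ (2 * (d + 1 + 1)))⁻¹ := by linarith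
  have h4 : (8 : ℝ) ^ E = 2 ^ E * 4 ^ E := by rw [← mul_pow]; norm_num
  have h5 : (2 * (m : ℝ) + 1) ^ (2 * (d + 1 + 1))
      = (2 * (m : ℝ) + 1) ^ (2 * (d + 1)) * (2 * (m : ℝ) + 1) ^ 2 := by ring
  rw [h5, one_div, inv_pow, ← mul_inv, ← mul_inv, ← div_eq_mul_inv, ← div_eq_mul_inv,
    div_le_div_iff₀ (by positivity) (by positivity)] at h3
  have hP : 0 < (2 * (m : ℝ) + 1) ^ (2 * (d + 1)) := by positivity
  have h6 : (a * (2 * (m : ℝ) + 1) ^ 2) * (2 * (m : ℝ) + 1) ^ (2 * (d + 1))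
      ≤ (8 ^ E * ((d : ℝ) + 1)) * (2 * (m : ℝ) + 1) ^ (2 * (d + 1)) := by
    rw [h4]; linarith
  exact absurd (le_of_mul_le_mul_right h6 hP) (not_le.2 ha)

/-- A point near the vertex `0` of the simplex has small weight. -/
lemma IsCubature.weight_le {d t E m : ℕ} {F : Formula (d + 1)}
    (hF : F.IsCubature t (uniform (d + 1))) (hpos : F.IsPositive) (hE : d + 2 ≤ E)
    (ht : 2 * E * m ≤ t) {p : Fin (d + 1) → ℝ} (hp : p ∈ F.points)
    (hsum : (2 * (m : ℝ) + 1) ^ 2 * ∑ i, p i ≤ 1) :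
    F.weight p ≤ 8 ^ E * ((d : ℝ) + 1) * ((2 * (m : ℝ) + 1) ^ (2 * (d + 1)))⁻¹ := by
  have h := hF.sum_weight_mul_eval ((natDegree_peak_le E m).trans ht)
  have h1 : F.weight p * (peak E m).eval (∑ i, p i)
      ≤ ∑ p ∈ F.points, F.weight p * (peak E m).eval (∑ i, p i) :=
    Finset.single_le_sum (f := fun p => F.weight p * (peak E m).eval (∑ i, p i))
      (fun x hx => mul_nonneg (hpos x hx).le (eval_peak_nonneg _ _ _)) hp
  rw [h] at h1
  have h2 := mul_le_mul_of_nonneg_left (le_eval_peak E m hsum) (hpos p hp).le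
  have h3 := mul_le_mul_of_nonneg_left (integral_peak_mul_pow_le E m d hE)
    (by positivity : (0 : ℝ) ≤ (d : ℝ) + 1)
  have h4 : (8 : ℝ) ^ E = 2 ^ E * 4 ^ E := by rw [← mul_pow]; norm_num
  have h5 := h2.trans (h1.trans h3)
  rw [one_div, inv_pow, ← div_eq_mul_inv, div_le_iff₀ (by positivity)] at h5
  rw [h4]
  linarith

end Formula

/-! ### Choice of scales and conclusion -/

/-- Some weight of a positive cubature formula of degree `t` on `Δₙ` is `O(t⁻²ⁿ)`. -/
theorem exists_weight_le (n : ℕ) :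
    ∃ C : ℝ, 0 < C ∧ ∀ t : ℕ, 1 ≤ t → ∀ F : Formula n,
      F.IsCubature t (uniform n) → F.IsPositive →
        ∃ p ∈ F.points, F.weight p ≤ C * ((t : ℝ) ^ (2 * n))⁻¹ := by
  have hsmall : ∀ {t : ℕ} {F : Formula n}, F.IsCubature t (uniform n) → F.IsPositive →
      ∃ p ∈ F.points, F.weight p ≤ 1 := by
    intro t F hF hpos
    have hne : F.points.Nonempty := by
      rw [Finset.nonempty_iff_ne_empty]
      intro h
      simpa [h] using hF.sum_weight
    obtain ⟨p, hp⟩ := hne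
    exact ⟨p, hp, hF.sum_weight ▸ Finset.single_le_sum (fun x hx => (hpos x hx).le) hp⟩
  rcases n with _ | d
  · exact ⟨1, one_pos, fun t _ F hF hpos => by simpa using hsmall hF hpos⟩
  -- The least exponent allowed by the moment bound of order `d + 1`.
  set E := d + 3 with hE
  obtain ⟨r, hr⟩ := exists_nat_gt ((8 : ℝ) ^ E * ((d : ℝ) + 1))
  set B : ℕ := 2 * E * (2 * r + 1) + 2 * E * r + 1 with hB
  refine ⟨8 ^ E * ((d : ℝ) + 1) * (B : ℝ) ^ (2 * (d + 1)), by positivity, fun t ht F hF hpos => ?_⟩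
  have htpos : (0 : ℝ) < t := by exact_mod_cast ht
  have h8 : 1 ≤ (8 : ℝ) ^ E * ((d : ℝ) + 1) :=
    one_le_mul_of_one_le_of_one_le (one_le_pow₀ (by norm_num)) (by simp)
  rcases lt_or_ge t (2 * E * r + 1) with hlt | hge
  · obtain ⟨p, hp, hw⟩ := hsmall hF hpos
    refine ⟨p, hp, hw.trans ?_⟩
    rw [← div_eq_mul_inv, one_le_div (by positivity)]
    have h1 : (t : ℝ) ≤ B := by exact_mod_cast (by omega : t ≤ B)
    exact (pow_le_pow_left₀ htpos.le h1 _).trans (le_mul_of_one_le_left (by positivity) h8)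
  -- Two scales: `m` for the weight bound and `M = (2r+1)m + r` for locating the point, so that `2M
  -- + 1 = (2r+1)(2m+1)`. With `a = (2m+1)⁻²` the gain `(2r+1)²` beats `8 ^ E * (d + 1)`. Here `m`
  -- is the largest value with `2EM + 1 ≤ t`.
  · set c := 2 * E * (2 * r + 1) with hc
    set m := (t - (2 * E * r + 1)) / c with hm
    have hdm : c * m ≤ t - (2 * E * r + 1) := Nat.mul_div_le _ _
    have hlt : t - (2 * E * r + 1) < c * (m + 1) := by
      exact Nat.lt_mul_div_succ _ (by positivity)
    have hdeg : 2 * E * ((2 * r + 1) * m + r) + 1 ≤ t := by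
      have : 2 * E * ((2 * r + 1) * m + r) = c * m + 2 * E * r := by rw [hc]; ring
      omega
    have hk : (0 : ℝ) < 2 * (m : ℝ) + 1 := by positivity
    have ha : 8 ^ E * ((d : ℝ) + 1) < ((2 * (m : ℝ) + 1) ^ 2)⁻¹ *
        (2 * (((2 * r + 1) * m + r : ℕ) : ℝ) + 1) ^ 2 := by
      have : 2 * (((2 * r + 1) * m + r : ℕ) : ℝ) + 1 = (2 * r + 1) * (2 * m + 1) := by
        push_cast; ring
      rw [this, mul_pow, mul_left_comm, inv_mul_cancel₀ (by positivity), mul_one]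
      nlinarith [Nat.cast_nonneg (α := ℝ) r]
    obtain ⟨p, hp, hlt'⟩ := hF.exists_sum_lt hpos le_rfl hdeg ha
    have hle : 2 * E * m ≤ t := by nlinarith
    refine ⟨p, hp, (hF.weight_le hpos (by omega) hle hp ?_).trans ?_⟩
    · have := mul_le_mul_of_nonneg_left hlt'.le (by positivity : 0 ≤ (2 * (m : ℝ) + 1) ^ 2)
      rwa [mul_inv_cancel₀ (by positivity)] at this
    · rw [mul_assoc _ ((B : ℝ) ^ _)]
      refine mul_le_mul_of_nonneg_left ?_ (by positivity)
      have htB : t ≤ B * (2 * m + 1) := by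
        have : t ≤ c * (m + 1) + 2 * E * r + 1 := by omega
        refine this.trans ?_
        rw [hB]
        nlinarith [Nat.zero_le (c * m), Nat.zero_le (E * r * m)]
      have htB' : (t : ℝ) ≤ B * (2 * m + 1) := by exact_mod_cast htB
      rw [← div_eq_mul_inv, inv_eq_one_div, div_le_div_iff₀ (by positivity) (by positivity),
        one_mul, ← mul_pow]
      exact pow_le_pow_left₀ htpos.le htB' _

end Cubature

theorem mainTheorem7 (n : ℕ) :
    (∃ C : ℝ, 0 < C ∧ ∀ t : ℕ, 1 ≤ t → ∀ F : Cubature.Formula n,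
      F.IsCubature t (Cubature.uniform n) → F.IsPositive →
        ∃ m : ℝ, F.IsLeastWeight m ∧ m ≤ C * ((t : ℝ) ^ (2 * n))⁻¹) ∧
    (∃ c : ℝ, 0 < c ∧ ∀ t : ℕ, 1 ≤ t → ∀ F : Cubature.Formula n,
      F.IsDesign t (Cubature.uniform n) → c * (t : ℝ) ^ (2 * n) ≤ (F.points.card : ℝ)) := by
  obtain ⟨C, hC, h⟩ := Cubature.exists_weight_le n
  refine ⟨⟨C, hC, fun t ht F hF hpos => ?_⟩, ⟨C⁻¹, inv_pos.2 hC, fun t ht F hF => ?_⟩⟩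
  · obtain ⟨p, hp, hw⟩ := h t ht F hF hpos
    obtain ⟨p₀, hp₀, hmin⟩ := F.points.exists_min_image F.weight ⟨p, hp⟩
    refine ⟨F.weight p₀, ⟨⟨p₀, hp₀, rfl⟩, ?_⟩, (hmin p hp).trans hw⟩
    rintro _ ⟨q, hq, rfl⟩
    exact hmin q hq
  · have hsum := hF.1.sum_weight
    have hcard : ∀ p ∈ F.points, (F.points.card : ℝ) * F.weight p = 1 := fun p hp => by
      rw [← hsum, Finset.sum_congr rfl fun q hq => hF.2.1 q hq p hp]
      simp
    -- The common weight is positive because the weights sum to `1`.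
    have hpos : F.IsPositive := fun p hp =>
      pos_of_mul_pos_right (by rw [hcard p hp]; exact one_pos) (Nat.cast_nonneg _)
    obtain ⟨p, hp, hw⟩ := h t ht F hF.1 hpos
    have htpos : (0 : ℝ) < t := by exact_mod_cast ht
    have h1 := mul_le_mul_of_nonneg_left hw (Nat.cast_nonneg (α := ℝ) F.points.card)
    rw [hcard p hp, ← div_eq_mul_inv, ← mul_div_assoc, one_le_div (by positivity)] at h1
    rwa [inv_mul_le_iff₀ hC, mul_comm C]
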